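/- Let $\mathbb D=\{z\in\mathbb C:|z|<1\}$, and let $\mathcal A$ be the class of analytic functions $f$ on $\mathbb D$ with $f(0)=0$ and $f'(0)=1$, written $f(z)=z+\sum_{n\ge 2}a_nz^n$ (and $a_1=1$). Let $\mathcal S^*_{\mathcal B}$ be the class of all $f\in\mathcal A$ with $$\frac{zf'(z)}{f(z)}\prec\sqrt{1+\tanh z},$$ that is, $f(z)\ne 0$ for $0<|z|<1$ and there is an analytic function $w$ on $\mathbb D$ with $w(0)=0$ and $|w(z)|\le|z|$ such that $zf'(z)/f(z)=\sqrt{1+\tanh w(z)}$ for all $z\in\mathbb D$ (principal square root; the left side is given the value $1$ at $z=0$). For $q,n\ge 1$ let $H_q(n)=\det\,(a_{n+i+j})_{0\le i,j\le q-1}$ be the Hankel determinant of $f$. **Theorem.** For every $f\in\mathcal S^*_{\mathcal B}$, $$H_3(1)=2a_2a_3a_4-a_3^3-a_4^2-a_2^2a_5+a_3a_5\qquad\text{and}\qquad |H_3(1)|\le\frac1{36}.$$ The bound is sharp: the function $$f_0(z)=z\exp\left(\int_0^z\frac{\sqrt{1+\tanh t^3}-1}{t}\,dt\right)$$ belongs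 to $\mathcal S^*_{\mathcal B}$, and for it $|H_3(1)|=\frac1{36}$. -/

import Mathlib

noncomputable section

/-- The class of analytic functions on the open unit disc, normalised by
`f 0 = 0` and `f' 0 = 1`. -/
def NormalizedAnalytic (f : ℂ → ℂ) : Prop :=
  DifferentiableOn ℂ f (Metric.ball 0 1) ∧ f 0 = 0 ∧ deriv f 0 = 1

/-- Schwarz functions: analytic on the open unit disc, with `w 0 = 0` and `|w z| ≤ |z|` there. -/
def IsSchwarzFunction (w : ℂ → ℂ) : Prop :=
  DifferentiableOn ℂ w (Metric.ball 0 1) ∧ w 0 = 0 ∧ ∀ z ∈ Metric.ball (0 : ℂ) 1, ‖w z‖ ≤ ‖z‖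

/-- Subordination `h ≺ g` of functions on the open unit disc. -/
def Subordinate (h g : ℂ → ℂ) : Prop :=
  ∃ w : ℂ → ℂ, IsSchwarzFunction w ∧ ∀ z ∈ Metric.ball (0 : ℂ) 1, h z = g (w z)

/-- The function `z f'(z) / f(z)`, with its removable singularity at `0` filled in by the
value `1`, which is its limit at `0` for every normalised `f`. -/
def starlikeQuotient (f : ℂ → ℂ) : ℂ → ℂ :=
  Function.update (fun z => z * deriv f z / f z) 0 1

/-- The bean function `√(1 + tanh z)`, with the principal branch of the square root.
On the open unit disc `1 + tanh z = 2 / (1 + exp (-2 z))` avoids the branch cut. -/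
def beanFunction (z : ℂ) : ℂ :=
  Complex.sqrt (1 + Complex.tanh z)

/-- The class `S*_B`: normalised analytic `f`, without zeros in the punctured disc (so that
`z f'(z) / f(z)` is a function on the disc), with `z f'(z) / f(z) ≺ √(1 + tanh z)`. -/
def StarlikeBean (f : ℂ → ℂ) : Prop :=
  NormalizedAnalytic f ∧ (∀ z ∈ Metric.ball (0 : ℂ) 1, z ≠ 0 → f z ≠ 0) ∧
    Subordinate (starlikeQuotient f) beanFunction

/-- The `n`-th Taylor coefficient of `f` at `0`. -/
def taylorCoeff (f : ℂ → ℂ) (n : ℕ) : ℂ :=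
  iteratedDeriv n f 0 / (n.factorial : ℂ)

/-- The Hankel determinant `H_q(n)` of `f`: the determinant of the `q × q` matrix whose
entry in row `i` and column `j` (counted from `0`) is the coefficient `a_{n+i+j}`. -/
def hankelDet (f : ℂ → ℂ) (q n : ℕ) : ℂ :=
  Matrix.det (Matrix.of fun i j : Fin q => taylorCoeff f (n + (i : ℕ) + (j : ℕ)))

/-- The complex integral of `F` along the straight segment from `0` to `z`. -/
def segmentIntegral (F : ℂ → ℂ) (z : ℂ) : ℂ :=
  ∫ s in (0 : ℝ)..1, F ((s : ℂ) * z) * z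

/-- The function `f₀(z) = z exp (∫₀ᶻ (√(1 + tanh t³) - 1) / t dt)`. At `t = 0` the division
convention gives the integrand the value `0`, which is its limit there. -/
def extremalBean (z : ℂ) : ℂ :=
  z * Complex.exp (segmentIntegral (fun t => (beanFunction (t ^ 3) - 1) / t) z)

end

open Metric Filter Topology
open scoped ComplexConjugate

/-! Write `z f' / f = φ ∘ w` with `φ` the bean function and `w` a Schwarz function. Since `φ² = 1 +
tanh`, `φ` solves `2 φ' = 2 φ - φ³`, so the coefficients of `φ ∘ w`, and then those of `f`, follow
recursively from those of `w`. Thus `36 H₃(1)` is a polynomial in the first four coefficients of `w`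
(`hankelDet_eq_of_schwarz`).

Three steps of the Schur algorithm express these by parameters `a, x, y, v` of the closed unit disc
(`IsSchwarzFunction.exists_schur_parameters`). Once like terms are collected, the triangle
inequality leaves a real inequality in `|a|, |x|, |y|` (`hankel_scalar_bound`). It reduces to two
polynomial inequalities on the unit square, read off from Bernstein expansions.

For `w = z³` only the term `-c₃²` of the polynomial survives, and the bound is attained. -/

/-! ### Calculus of Taylor coefficients. -/

theorem taylorCoeff_zero (f : ℂ → ℂ) : taylorCoeff f 0 = f 0 := by simp [taylorCoeff]

theorem taylorCoeff_one (f : ℂ → ℂ) : taylorCoeff f 1 = deriv f 0 := by simp [taylorCoeff]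

theorem taylorCoeff_congr {f g : ℂ → ℂ} (h : f =ᶠ[𝓝 0] g) (n : ℕ) :
    taylorCoeff f n = taylorCoeff g n := by
  rw [taylorCoeff, taylorCoeff, h.iteratedDeriv_eq]

theorem taylorCoeff_congr_ball {f g : ℂ → ℂ} (h : ∀ z ∈ ball (0 : ℂ) 1, f z = g z) (n : ℕ) :
    taylorCoeff f n = taylorCoeff g n :=
  taylorCoeff_congr (eventually_of_mem (ball_mem_nhds _ one_pos) h) n

theorem taylorCoeff_sub {f g : ℂ → ℂ} (hf : AnalyticAt ℂ f 0) (hg : AnalyticAt ℂ g 0) (n : ℕ) :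
    taylorCoeff (fun z => f z - g z) n = taylorCoeff f n - taylorCoeff g n := by
  simp only [taylorCoeff, ← sub_div]
  rw [← iteratedDeriv_sub hf.contDiffAt hg.contDiffAt]
  rfl

theorem taylorCoeff_const_mul (c : ℂ) (f : ℂ → ℂ) (n : ℕ) :
    taylorCoeff (fun z => c * f z) n = c * taylorCoeff f n := by
  rw [taylorCoeff, taylorCoeff, iteratedDeriv_const_mul_field, mul_div_assoc]

theorem taylorCoeff_const_succ (c : ℂ) (n : ℕ) : taylorCoeff (fun _ => c) (n + 1) = 0 := by
  simp [taylorCoeff, iteratedDeriv_const]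

theorem taylorCoeff_id (n : ℕ) : taylorCoeff (fun z => z) n = if n = 1 then 1 else 0 := by
  rw [taylorCoeff, iteratedDeriv_fun_id_zero]
  split_ifs with h <;> simp [h]

theorem taylorCoeff_deriv (f : ℂ → ℂ) (n : ℕ) :
    taylorCoeff (deriv f) n = (n + 1) * taylorCoeff f (n + 1) := by
  rw [taylorCoeff, taylorCoeff, iteratedDeriv_succ', Nat.factorial_succ]
  have : (n.factorial : ℂ) ≠ 0 := by exact_mod_cast n.factorial_ne_zero
  have : (n : ℂ) + 1 ≠ 0 := by exact_mod_cast n.succ_ne_zero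
  push_cast
  field_simp

/-- The Cauchy product formula. -/
theorem taylorCoeff_mul {f g : ℂ → ℂ} (hf : AnalyticAt ℂ f 0) (hg : AnalyticAt ℂ g 0) (n : ℕ) :
    taylorCoeff (fun z => f z * g z) n =
      ∑ i ∈ Finset.range (n + 1), taylorCoeff f i * taylorCoeff g (n - i) := by
  simp only [taylorCoeff]
  rw [iteratedDeriv_fun_mul hf.contDiffAt hg.contDiffAt, Finset.sum_div]
  refine Finset.sum_congr rfl fun i hi => ?_
  rw [Nat.cast_choose _ (Nat.lt_succ_iff.1 (Finset.mem_range.1 hi))]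
  have (m : ℕ) : (m.factorial : ℂ) ≠ 0 := by exact_mod_cast m.factorial_ne_zero
  field_simp [this]

theorem taylorCoeff_id_mul_succ {f : ℂ → ℂ} (hf : AnalyticAt ℂ f 0) (n : ℕ) :
    taylorCoeff (fun z => z * f z) (n + 1) = taylorCoeff f n := by
  rw [taylorCoeff_mul (f := fun z => z) analyticAt_id hf, Finset.sum_eq_single 1]
  · simp [taylorCoeff_id]
  · intro i _ hi
    simp [taylorCoeff_id, hi]
  · simp

theorem analyticAt_zero_of_differentiableOn {f : ℂ → ℂ} (hf : DifferentiableOn ℂ f (ball 0 1)) :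
    AnalyticAt ℂ f 0 :=
  hf.analyticAt (ball_mem_nhds _ one_pos)

/-! ### The Schur algorithm. -/

/-- The Schur class: analytic functions on the unit disc that are bounded by `1`. -/
def IsSchurFunction (g : ℂ → ℂ) : Prop :=
  DifferentiableOn ℂ g (ball 0 1) ∧ ∀ z ∈ ball (0 : ℂ) 1, ‖g z‖ ≤ 1

theorem IsSchurFunction.norm_taylorCoeff_zero_le {g : ℂ → ℂ} (hg : IsSchurFunction g) :
    ‖taylorCoeff g 0‖ ≤ 1 := by
  rw [taylorCoeff_zero]
  exact hg.2 0 (mem_ball_self one_pos)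

theorem norm_sub_le_norm_one_sub_conj_mul {a b : ℂ} (ha : ‖a‖ ≤ 1) (hb : ‖b‖ ≤ 1) :
    ‖b - a‖ ≤ ‖1 - conj a * b‖ := by
  have h : ‖1 - conj a * b‖ ^ 2 - ‖b - a‖ ^ 2 = (1 - ‖a‖ ^ 2) * (1 - ‖b‖ ^ 2) := by
    simp only [Complex.sq_norm, Complex.normSq_apply, Complex.sub_re, Complex.sub_im,
      Complex.mul_re, Complex.mul_im, Complex.conj_re, Complex.conj_im, Complex.one_re,
      Complex.one_im]
    ring
  have h' : 0 ≤ (1 - ‖a‖ ^ 2) * (1 - ‖b‖ ^ 2) :=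
    mul_nonneg (sub_nonneg.2 (pow_le_one₀ (norm_nonneg _) ha))
      (sub_nonneg.2 (pow_le_one₀ (norm_nonneg _) hb))
  exact abs_le_of_sq_le_sq' (by linarith) (norm_nonneg _) |>.2

/-- A Schwarz function divided by the variable is a Schur function. -/
theorem exists_isSchurFunction_of_schwarz {k : ℂ → ℂ} (hk : DifferentiableOn ℂ k (ball 0 1))
    (hk0 : k 0 = 0) (hb : ∀ z ∈ ball (0 : ℂ) 1, ‖k z‖ ≤ 1) :
    ∃ h, IsSchurFunction h ∧ ∀ z, k z = z * h z := by
  refine ⟨dslope k 0, ⟨(Complex.differentiableOn_dslope (ball_mem_nhds _ one_pos)).2 hk,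
    fun z hz => ?_⟩, fun z => ?_⟩
  · have := Complex.norm_dslope_le_div_of_mapsTo_ball (R₂ := 1) hk
      (fun z hz => by simpa [hk0] using hb z hz) hz
    simpa using this
  · simpa [hk0] using (sub_smul_dslope k 0 z).symm

/-- One step of the Schur algorithm. -/
theorem IsSchurFunction.exists_step {g : ℂ → ℂ} (hg : IsSchurFunction g) :
    ∃ h, IsSchurFunction h ∧
      ∀ z ∈ ball (0 : ℂ) 1, g z - g 0 = z * (h z * (1 - conj (g 0) * g z)) := by
  have h0 := hg.2 0 (mem_ball_self one_pos)
  rcases h0.eq_or_lt with h1 | h1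
  -- If `|g 0| = 1`, the maximum principle makes `g` constant.
  · refine ⟨fun _ => 0, ⟨differentiableOn_const 0, by simp⟩, fun z hz => ?_⟩
    have := Complex.eqOn_of_isPreconnected_of_isMaxOn_norm (convex_ball (0 : ℂ) 1).isPreconnected
      isOpen_ball hg.1 (mem_ball_self one_pos) (fun z hz => by simpa [h1] using hg.2 z hz) hz
    simpa [sub_eq_zero] using this
  · have hne : ∀ z ∈ ball (0 : ℂ) 1, 1 - conj (g 0) * g z ≠ 0 := by
      intro z hz h
      have : ‖conj (g 0) * g z‖ < 1 := by
        rw [norm_mul, RCLike.norm_conj]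
        exact mul_lt_one_of_nonneg_of_lt_one_left (norm_nonneg _) h1 (hg.2 z hz)
      rw [← sub_eq_zero.1 h, norm_one] at this
      exact lt_irrefl _ this
    obtain ⟨h, hh, hk⟩ := exists_isSchurFunction_of_schwarz
      (k := fun z => (g z - g 0) / (1 - conj (g 0) * g z))
      ((hg.1.sub_const _).div ((hg.1.const_mul _).const_sub _) hne) (by simp) (fun z hz => by
        rw [norm_div]
        exact div_le_one_of_le₀ (norm_sub_le_norm_one_sub_conj_mul h0 (hg.2 z hz))
          (norm_nonneg _))
    refine ⟨h, hh, fun z hz => ?_⟩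
    rw [← mul_assoc, ← hk z, div_mul_cancel₀ _ (hne z hz)]

/-- The Schur step is kept as a product, so the Cauchy formula applies and the case `|g 0| = 1`
needs no separate treatment. -/
theorem IsSchurFunction.exists_taylorCoeff_step {g : ℂ → ℂ} (hg : IsSchurFunction g) :
    ∃ h, IsSchurFunction h ∧ ∀ n, taylorCoeff g (n + 1) = taylorCoeff h n -
      conj (taylorCoeff g 0) *
        ∑ i ∈ Finset.range (n + 1), taylorCoeff h i * taylorCoeff g (n - i) := by
  obtain ⟨h, hh, hgh⟩ := hg.exists_step
  refine ⟨h, hh, fun n => ?_⟩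
  have ag := analyticAt_zero_of_differentiableOn hg.1
  have ah := analyticAt_zero_of_differentiableOn hh.1
  have e1 : taylorCoeff (fun z => g z - g 0) (n + 1) = taylorCoeff g (n + 1) := by
    rw [taylorCoeff_sub ag analyticAt_const, taylorCoeff_const_succ, sub_zero]
  rw [← e1, taylorCoeff_congr_ball hgh, taylorCoeff_id_mul_succ (by fun_prop),
    taylorCoeff_congr_ball (g := fun z => h z - conj (g 0) * (h z * g z)) (fun z _ => by ring),
    taylorCoeff_sub ah (by fun_prop), taylorCoeff_const_mul, taylorCoeff_mul ah ag,
    taylorCoeff_zero g]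

/-- The coefficients `c₁, …, c₄` of a Schwarz function in terms of its Schur parameters. -/
theorem IsSchwarzFunction.exists_schur_parameters {w : ℂ → ℂ} (hw : IsSchwarzFunction w) :
    ∃ a x y v : ℂ, ‖a‖ ≤ 1 ∧ ‖x‖ ≤ 1 ∧ ‖y‖ ≤ 1 ∧ ‖v‖ ≤ 1 ∧
      taylorCoeff w 1 = a ∧
      taylorCoeff w 2 = (1 - conj a * a) * x ∧
      taylorCoeff w 3 = (1 - conj a * a) * ((1 - conj x * x) * y - conj a * x ^ 2) ∧
      taylorCoeff w 4 = (1 - conj a * a) * ((1 - conj x * x) * (1 - conj y * y) * v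
        + conj a ^ 2 * x ^ 3 - (1 - conj x * x) * (2 * conj a * x * y + conj x * y ^ 2)) := by
  obtain ⟨hd, h0, hb⟩ := hw
  obtain ⟨g, hg, hwg⟩ := exists_isSchurFunction_of_schwarz hd h0
    (fun z hz => (hb z hz).trans (mem_ball_zero_iff.1 hz).le)
  have hc (n : ℕ) : taylorCoeff w (n + 1) = taylorCoeff g n := by
    rw [taylorCoeff_congr_ball fun z _ => hwg z,
      taylorCoeff_id_mul_succ (analyticAt_zero_of_differentiableOn hg.1)]
  obtain ⟨h, hh, egh⟩ := hg.exists_taylorCoeff_step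
  obtain ⟨k, hk, ehk⟩ := hh.exists_taylorCoeff_step
  obtain ⟨l, hl, ekl⟩ := hk.exists_taylorCoeff_step
  refine ⟨_, _, _, _, hg.norm_taylorCoeff_zero_le, hh.norm_taylorCoeff_zero_le,
    hk.norm_taylorCoeff_zero_le, hl.norm_taylorCoeff_zero_le, hc 0, ?_⟩
  have g1 := egh 0
  have g2 := egh 1
  have g3 := egh 2
  have h1 := ehk 0
  have h2 := ehk 1
  have k1 := ekl 0
  simp only [Finset.sum_range_succ, Finset.sum_range_zero, zero_add, Nat.sub_zero, Nat.sub_self,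
    Nat.reduceAdd, Nat.reduceSub] at g1 g2 g3 h1 h2 k1
  rw [hc 1, hc 2, hc 3, g3, g2, g1, h2, h1, k1]
  refine ⟨?_, ?_, ?_⟩ <;> ring

/-! ### Analyticity of the bean function and its differential equation. -/

/-- `1 + tanh z`, written without a hyperbolic function. -/
theorem one_add_tanh_mul {z : ℂ} (hz : Complex.cosh z ≠ 0) :
    (1 + Complex.tanh z) * (1 + Complex.exp (-(2 * z))) = 2 := by
  have h : Complex.exp (-(2 * z)) = Complex.exp (-z) * Complex.exp (-z) := by
    rw [← Complex.exp_add]; ring_nf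
  have h1 : Complex.exp z * Complex.exp (-z) = 1 := by rw [← Complex.exp_add]; simp
  rw [Complex.tanh_eq_sinh_div_cosh]
  field_simp
  rw [Complex.cosh, Complex.sinh, h]
  linear_combination Complex.exp (-z) * h1

/-- The imaginary part is a nonzero multiple of `sin (2 Im z)` with `|2 Im z| < 2 < π`, so it
vanishes only for real `z`, where the real part is positive. -/
theorem one_add_exp_mem_slitPlane {z : ℂ} (hz : z ∈ ball (0 : ℂ) 1) :
    1 + Complex.exp (-(2 * z)) ∈ Complex.slitPlane := by
  have him : |z.im| < 1 := (Complex.abs_im_le_norm z).trans_lt (mem_ball_zero_iff.1 hz)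
  obtain ⟨h1, h2⟩ := abs_lt.1 him
  have hpi := Real.pi_gt_three
  rw [Complex.mem_slitPlane_iff]
  by_cases h : z.im = 0
  · left
    simp only [Complex.add_re, Complex.one_re, Complex.exp_re]
    have : Real.cos (-(2 * z)).im = 1 := by simp [h]
    rw [this]
    positivity
  · right
    simp only [Complex.add_im, Complex.one_im, Complex.exp_im, zero_add]
    refine mul_ne_zero (Real.exp_pos _).ne' fun h0 => h ?_
    have hi : (-(2 * z)).im = -(2 * z.im) := by simp
    rw [hi, Real.sin_eq_zero_iff_of_lt_of_lt (by linarith) (by linarith)] at h0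
    linarith

theorem cosh_ne_zero_of_mem_ball {z : ℂ} (hz : z ∈ ball (0 : ℂ) 1) : Complex.cosh z ≠ 0 := by
  intro h
  refine Complex.slitPlane_ne_zero (one_add_exp_mem_slitPlane hz) ?_
  have h1 : Complex.exp z * Complex.exp (-z) = 1 := by rw [← Complex.exp_add]; simp
  have h2 : Complex.exp (-(2 * z)) = Complex.exp (-z) * Complex.exp (-z) := by
    rw [← Complex.exp_add]; ring_nf
  rw [Complex.cosh] at h
  rw [h2]
  linear_combination 2 * Complex.exp (-z) * h - h1

theorem one_add_tanh_mem_slitPlane {z : ℂ} (hz : z ∈ ball (0 : ℂ) 1) :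
    1 + Complex.tanh z ∈ Complex.slitPlane := by
  have h := one_add_exp_mem_slitPlane hz
  have h' := one_add_tanh_mul (cosh_ne_zero_of_mem_ball hz)
  have h0 := Complex.slitPlane_ne_zero h
  rw [← eq_div_iff h0] at h'
  rw [h', show (2 : ℂ) / _ = ((2 : ℝ) : ℂ) * (1 + Complex.exp (-(2 * z)))⁻¹ by
    rw [div_eq_mul_inv]; norm_num]
  rw [Complex.mem_slitPlane_iff, Complex.re_ofReal_mul, Complex.im_ofReal_mul,
    Complex.inv_re, Complex.inv_im]
  have hn := Complex.normSq_pos.2 h0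
  rcases Complex.mem_slitPlane_iff.1 h with h | h
  · left; positivity
  · right
    exact mul_ne_zero two_ne_zero (div_ne_zero (neg_ne_zero.2 h) hn.ne')

theorem beanFunction_sq (z : ℂ) : beanFunction z ^ 2 = 1 + Complex.tanh z := by
  simp [beanFunction, Complex.sqrt]

theorem beanFunction_zero : beanFunction 0 = 1 := by simp [beanFunction]

theorem hasDerivAt_tanh {z : ℂ} (hz : Complex.cosh z ≠ 0) :
    HasDerivAt Complex.tanh (1 - Complex.tanh z ^ 2) z := by
  have h := (Complex.hasDerivAt_sinh z).div (Complex.hasDerivAt_cosh z) hz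
  have e : Complex.tanh = fun z => Complex.sinh z / Complex.cosh z :=
    funext fun z => Complex.tanh_eq_sinh_div_cosh z
  rw [e]
  refine h.congr_deriv ?_
  field_simp

theorem differentiableAt_beanFunction {z : ℂ} (hz : z ∈ ball (0 : ℂ) 1) :
    DifferentiableAt ℂ beanFunction z :=
  (Complex.differentiableAt_sqrt (one_add_tanh_mem_slitPlane hz)).comp z
    ((hasDerivAt_tanh (cosh_ne_zero_of_mem_ball hz)).differentiableAt.const_add 1)

/-- The differential equation `2 φ' = 2 φ - φ³` of the bean function. -/
theorem two_mul_deriv_beanFunction {z : ℂ} (hz : z ∈ ball (0 : ℂ) 1) :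
    2 * deriv beanFunction z = 2 * beanFunction z - beanFunction z ^ 3 := by
  have h1 := (differentiableAt_beanFunction hz).hasDerivAt.pow 2
  have h2 := (hasDerivAt_tanh (cosh_ne_zero_of_mem_ball hz)).const_add 1
  have h3 : beanFunction ^ 2 = fun z => 1 + Complex.tanh z := funext beanFunction_sq
  rw [h3] at h1
  have h4 := h1.unique h2
  have hs := beanFunction_sq z
  have hne : beanFunction z ≠ 0 := by
    intro h
    refine Complex.slitPlane_ne_zero (one_add_tanh_mem_slitPlane hz) ?_
    rw [← hs, h]; norm_num
  have ht : Complex.tanh z = beanFunction z ^ 2 - 1 := by rw [hs]; ring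
  rw [ht] at h4
  -- Differentiating `φ² = 1 + tanh` gives `2 φ φ' = 1 - (φ² - 1)² = φ (2 φ - φ³)`.
  refine mul_left_cancel₀ hne ?_
  simp at h4
  linear_combination h4

/-! ### From the coefficients of `w` to the Hankel determinant. -/

theorem IsSchwarzFunction.mem_ball {w : ℂ → ℂ} (hw : IsSchwarzFunction w) {z : ℂ}
    (hz : z ∈ ball (0 : ℂ) 1) : w z ∈ ball (0 : ℂ) 1 :=
  mem_ball_zero_iff.2 ((hw.2.2 z hz).trans_lt (mem_ball_zero_iff.1 hz))

theorem IsSchwarzFunction.differentiableOn_beanFunction_comp {w : ℂ → ℂ}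
    (hw : IsSchwarzFunction w) :
    DifferentiableOn ℂ (fun z => beanFunction (w z)) (ball 0 1) := fun z hz =>
  ((differentiableAt_beanFunction (hw.mem_ball hz)).comp_differentiableWithinAt z (hw.1 z hz))

/-- The coefficients of `φ ∘ w` for a Schwarz function `w`. -/
theorem IsSchwarzFunction.taylorCoeff_beanFunction_comp {w : ℂ → ℂ} (hw : IsSchwarzFunction w)
    {p : ℂ → ℂ} (hp : p = fun z => beanFunction (w z)) :
    taylorCoeff p 0 = 1 ∧
    taylorCoeff p 1 = taylorCoeff w 1 / 2 ∧
    taylorCoeff p 2 = taylorCoeff w 2 / 2 - taylorCoeff w 1 ^ 2 / 8 ∧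
    taylorCoeff p 3 = taylorCoeff w 3 / 2 - taylorCoeff w 1 * taylorCoeff w 2 / 4
      - 5 / 48 * taylorCoeff w 1 ^ 3 ∧
    taylorCoeff p 4 = taylorCoeff w 4 / 2 - taylorCoeff w 1 * taylorCoeff w 3 / 4
      - taylorCoeff w 2 ^ 2 / 8 - 5 / 16 * taylorCoeff w 1 ^ 2 * taylorCoeff w 2
      + 17 / 384 * taylorCoeff w 1 ^ 4 := by
  have aw := analyticAt_zero_of_differentiableOn hw.1
  have ap : AnalyticAt ℂ p 0 := by
    rw [hp]
    exact analyticAt_zero_of_differentiableOn hw.differentiableOn_beanFunction_comp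
  -- This equation determines each coefficient of `p` from the earlier ones and those of `w`.
  have hode : ∀ z ∈ ball (0 : ℂ) 1,
      2 * deriv p z = (2 * p z - p z * (p z * p z)) * deriv w z := by
    intro z hz
    have hd := (differentiableAt_beanFunction (hw.mem_ball hz)).hasDerivAt.comp z
      (hw.1.differentiableAt (isOpen_ball.mem_nhds hz)).hasDerivAt
    have : deriv p z = deriv beanFunction (w z) * deriv w z := by rw [hp]; exact hd.deriv
    rw [this, ← mul_assoc, two_mul_deriv_beanFunction (hw.mem_ball hz), hp]
    ring
  have p0 : taylorCoeff p 0 = 1 := by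
    simp only [taylorCoeff_zero, hp, hw.2.1, beanFunction_zero]
  have key (n : ℕ) := (taylorCoeff_const_mul 2 (deriv p) n).symm.trans
    ((taylorCoeff_congr_ball hode n).trans (taylorCoeff_mul (by fun_prop) aw.deriv n))
  have hb (n : ℕ) : taylorCoeff (fun z => 2 * p z - p z * (p z * p z)) n =
      2 * taylorCoeff p n - ∑ i ∈ Finset.range (n + 1), taylorCoeff p i *
        ∑ j ∈ Finset.range (n - i + 1), taylorCoeff p j * taylorCoeff p (n - i - j) := by
    rw [taylorCoeff_sub (by fun_prop) (by fun_prop), taylorCoeff_const_mul,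
      taylorCoeff_mul ap (by fun_prop)]
    simp only [taylorCoeff_mul ap ap]
  simp only [hb, taylorCoeff_deriv] at key
  have k0 := key 0
  have k1 := key 1
  have k2 := key 2
  have k3 := key 3
  simp only [Finset.sum_range_succ, Finset.sum_range_zero, zero_add, Nat.sub_zero, Nat.sub_self,
    Nat.reduceAdd, Nat.reduceSub, p0, Nat.cast_zero, Nat.cast_one, Nat.cast_ofNat] at k0 k1 k2 k3
  have p1 : taylorCoeff p 1 = taylorCoeff w 1 / 2 := by linear_combination k0 / 2
  rw [p1] at k1 k2 k3
  have p2 : taylorCoeff p 2 = taylorCoeff w 2 / 2 - taylorCoeff w 1 ^ 2 / 8 := by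
    linear_combination k1 / 4
  rw [p2] at k2 k3
  have p3 : taylorCoeff p 3 = taylorCoeff w 3 / 2 - taylorCoeff w 1 * taylorCoeff w 2 / 4
      - 5 / 48 * taylorCoeff w 1 ^ 3 := by
    linear_combination k2 / 6
  rw [p3] at k3
  refine ⟨p0, p1, p2, p3, ?_⟩
  linear_combination k3 / 8

/-- The coefficients of `f` in terms of those of `p = z f' / f`. -/
theorem taylorCoeff_of_mul_deriv_eq {f p : ℂ → ℂ} (hf : AnalyticAt ℂ f 0) (hp : AnalyticAt ℂ p 0)
    (h : ∀ z ∈ ball (0 : ℂ) 1, z * deriv f z = p z * f z) (n : ℕ) :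
    (n + 1) * taylorCoeff f (n + 1) =
      ∑ i ∈ Finset.range (n + 2), taylorCoeff p i * taylorCoeff f (n + 1 - i) := by
  rw [← taylorCoeff_mul hp hf, ← taylorCoeff_congr_ball h, taylorCoeff_id_mul_succ hf.deriv,
    taylorCoeff_deriv]

theorem hankelDet_three_one {f : ℂ → ℂ} (hf : deriv f 0 = 1) :
    hankelDet f 3 1 = 2 * taylorCoeff f 2 * taylorCoeff f 3 * taylorCoeff f 4
      - taylorCoeff f 3 ^ 3 - taylorCoeff f 4 ^ 2 - taylorCoeff f 2 ^ 2 * taylorCoeff f 5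
      + taylorCoeff f 3 * taylorCoeff f 5 := by
  have h1 : taylorCoeff f 1 = 1 := by rw [taylorCoeff_one, hf]
  simp only [hankelDet, Matrix.det_fin_three, Matrix.of_apply]
  norm_num [h1]
  ring

theorem hankelDet_eq_of_schwarz {f w : ℂ → ℂ} (hf : NormalizedAnalytic f)
    (hw : IsSchwarzFunction w)
    (h : ∀ z ∈ ball (0 : ℂ) 1, z * deriv f z = beanFunction (w z) * f z) {a b c d : ℂ}
    (ha : taylorCoeff w 1 = a) (hb : taylorCoeff w 2 = b) (hc : taylorCoeff w 3 = c)
    (hd : taylorCoeff w 4 = d) :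
    36 * hankelDet f 3 1 = -(1099 / 9216) * a ^ 6 + 257 / 768 * a ^ 4 * b + 149 / 192 * a ^ 3 * c
      - 67 / 64 * a ^ 2 * b ^ 2 - 27 / 32 * a ^ 2 * d + 19 / 16 * a * b * c - 9 / 16 * b ^ 3
      + 9 / 8 * b * d - c ^ 2 := by
  have hp := hw.differentiableOn_beanFunction_comp
  obtain ⟨p0, p1, p2, p3, p4⟩ := hw.taylorCoeff_beanFunction_comp rfl
  have key := taylorCoeff_of_mul_deriv_eq (analyticAt_zero_of_differentiableOn hf.1)
    (analyticAt_zero_of_differentiableOn hp) h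
  have f0 : taylorCoeff f 0 = 0 := by rw [taylorCoeff_zero, hf.2.1]
  have f1 : taylorCoeff f 1 = 1 := by rw [taylorCoeff_one, hf.2.2]
  have k1 := key 1
  have k2 := key 2
  have k3 := key 3
  have k4 := key 4
  simp only [Finset.sum_range_succ, Finset.sum_range_zero, zero_add, Nat.sub_zero, Nat.sub_self,
    Nat.reduceAdd, Nat.reduceSub, Nat.cast_one, Nat.cast_ofNat, f0, f1, p0, p1, p2, p3, p4,
    ha, hb, hc, hd] at k1 k2 k3 k4
  have f2 : taylorCoeff f 2 = a / 2 := by linear_combination k1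
  rw [f2] at k2 k3 k4
  have f3 : taylorCoeff f 3 = a ^ 2 / 16 + b / 4 := by linear_combination k2 / 2
  rw [f3] at k3 k4
  have f4 : taylorCoeff f 4 = -(13 / 288) * a ^ 3 + a * b / 24 + c / 6 := by
    linear_combination k3 / 3
  rw [f4] at k4
  have f5 : taylorCoeff f 5 = -(11 / 1152) * a ^ 4 - 5 / 48 * a ^ 2 * b + a * c / 48 + d / 8 := by
    linear_combination k4 / 4
  rw [hankelDet_three_one hf.2.2, f2, f3, f4, f5]
  ring

/-! ### The real inequality. -/

/-- Products of Bernstein polynomials are nonnegative on the unit square. -/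
theorem bernstein_product_nonneg {u r : ℝ} (hu : 0 ≤ u) (hu' : u ≤ 1) (hr : 0 ≤ r) (hr' : r ≤ 1)
    (i j k l : ℕ) : 0 ≤ u ^ i * (1 - u) ^ j * (r ^ k * (1 - r) ^ l) := by
  have := sub_nonneg.2 hu'
  have := sub_nonneg.2 hr'
  positivity

/-- The `y = 1` end of `hankel_scalar_bound`, with `u = a²` and odd powers of `a` removed. -/
theorem poly_bound_A {u r : ℝ} (hu : 0 ≤ u) (hu' : u ≤ 1) (hr : 0 ≤ r) (hr' : r ≤ 1) :
    1099 / 9216 * u ^ 3 + 257 / 768 * u ^ 2 * (1 - u) * r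
      + (149 / 192 * u ^ 2 * (1 - u) + 67 / 64 * u * (1 - u) ^ 2) * r ^ 2
      + (19 / 16 * u * (1 - u) ^ 2 + 9 / 16 * (1 - u) ^ 3 + 27 / 32 * u ^ 2 * (1 - u)) * r ^ 3
      + 1 / 8 * u * (1 - u) ^ 2 * r ^ 4
      + (1 - u) * (1 - r ^ 2) * (149 / 192 * u * ((1 + u) / 2)
        + (19 / 16 * (1 - u) + 27 / 16 * u) * (3 / 4 * u + r ^ 2 / 3)
        + (1 - u) * r ^ 2 / 4 * ((1 + u) / 2))
      + (1 - u) * (1 - r ^ 2) * ((1 - u) * (1 + r ^ 2 / 8) + 27 / 32 * u * r) ≤ 1 := by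
  have h := bernstein_product_nonneg hu hu' hr hr'
  -- In the Bernstein expansion of the difference, `u (1 - u)² r³ (1 - r)` has a negative
  -- coefficient; the cross term of this square absorbs it.
  have hq : 0 ≤ u * (1 - u) ^ 2 * (r * (1 - 2 * r)) ^ 2 :=
    mul_nonneg (mul_nonneg hu (sq_nonneg _)) (sq_nonneg _)
  linarith [h 0 3 0 4, h 0 3 1 3, h 0 3 2 2, h 0 3 3 1, h 0 3 4 0,
    h 1 2 0 4, h 1 2 1 3, h 1 2 2 2, h 1 2 3 1, h 1 2 4 0,
    h 2 1 0 4, h 2 1 1 3, h 2 1 2 2, h 2 1 3 1, h 2 1 4 0,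
    h 3 0 0 4, h 3 0 1 3, h 3 0 2 2, h 3 0 3 1, h 3 0 4 0]

/-- The `y = 0` end, except that the terms linear in `y` are kept at their bound for `y = 1`. The
square plays the same role as in `poly_bound_A`. -/
theorem poly_bound_D {u r : ℝ} (hu : 0 ≤ u) (hu' : u ≤ 1) (hr : 0 ≤ r) (hr' : r ≤ 1) :
    1099 / 9216 * u ^ 3 + 257 / 768 * u ^ 2 * (1 - u) * r
      + (149 / 192 * u ^ 2 * (1 - u) + 67 / 64 * u * (1 - u) ^ 2) * r ^ 2
      + (19 / 16 * u * (1 - u) ^ 2 + 9 / 16 * (1 - u) ^ 3 + 27 / 32 * u ^ 2 * (1 - u)) * r ^ 3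
      + 1 / 8 * u * (1 - u) ^ 2 * r ^ 4
      + (1 - u) * (1 - r ^ 2) * (149 / 192 * u * ((1 + u) / 2)
        + (19 / 16 * (1 - u) + 27 / 16 * u) * (3 / 4 * u + r ^ 2 / 3)
        + (1 - u) * r ^ 2 / 4 * ((1 + u) / 2))
      + (1 - u) * (1 - r ^ 2) * (9 / 8 * ((1 - u) * r + 3 / 4 * u)) ≤ 1 := by
  have h := bernstein_product_nonneg hu hu' hr hr'
  have hq : 0 ≤ u * (1 - u) ^ 2 * (r * (1 - 2 * r)) ^ 2 :=
    mul_nonneg (mul_nonneg hu (sq_nonneg _)) (sq_nonneg _)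
  linarith [h 0 3 0 4, h 0 3 1 3, h 0 3 2 2, h 0 3 3 1, h 0 3 4 0,
    h 1 2 0 4, h 1 2 1 3, h 1 2 2 2, h 1 2 3 1, h 1 2 4 0,
    h 2 1 0 4, h 2 1 1 3, h 2 1 2 2, h 2 1 3 1, h 2 1 4 0,
    h 3 0 0 4, h 3 0 1 3, h 3 0 2 2, h 3 0 3 1, h 3 0 4 0]

theorem hankel_scalar_bound {a r y : ℝ} (ha : 0 ≤ a) (ha' : a ≤ 1) (hr : 0 ≤ r) (hr' : r ≤ 1)
    (hy : 0 ≤ y) (hy' : y ≤ 1) :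
    1099 / 9216 * a ^ 6 + 257 / 768 * a ^ 4 * (1 - a ^ 2) * r
      + (149 / 192 * a ^ 4 * (1 - a ^ 2) + 67 / 64 * a ^ 2 * (1 - a ^ 2) ^ 2) * r ^ 2
      + (19 / 16 * a ^ 2 * (1 - a ^ 2) ^ 2 + 9 / 16 * (1 - a ^ 2) ^ 3
        + 27 / 32 * a ^ 4 * (1 - a ^ 2)) * r ^ 3
      + 1 / 8 * a ^ 2 * (1 - a ^ 2) ^ 2 * r ^ 4
      + (1 - a ^ 2) * (1 - r ^ 2) * (149 / 192 * a ^ 3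
        + (19 / 16 * (1 - a ^ 2) + 27 / 16 * a ^ 2) * (a * r) + a * (1 - a ^ 2) * r ^ 2 / 4) * y
      + (1 - a ^ 2) * (1 - r ^ 2) * ((1 - a ^ 2) * (1 + r ^ 2 / 8) + 27 / 32 * a ^ 2 * r) * y ^ 2
      + (1 - a ^ 2) * (1 - r ^ 2) * (9 / 8 * ((1 - a ^ 2) * r + 3 / 4 * a ^ 2)) * (1 - y ^ 2)
      ≤ 1 := by
  have hu : 0 ≤ a ^ 2 := sq_nonneg a
  have hu' : a ^ 2 ≤ 1 := pow_le_one₀ ha ha'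
  have hs : 0 ≤ 1 - a ^ 2 := sub_nonneg.2 hu'
  have ht : 0 ≤ 1 - r ^ 2 := sub_nonneg.2 (pow_le_one₀ hr hr')
  have hA := poly_bound_A hu hu' hr hr'
  have hD := poly_bound_D hu hu' hr hr'
  -- These two estimates turn the odd powers of `a` in the terms linear in `y` into polynomials in
  -- `a²`.
  have ham : a ≤ (1 + a ^ 2) / 2 := by nlinarith [sq_nonneg (a - 1)]
  have har : a * r ≤ 3 / 4 * a ^ 2 + r ^ 2 / 3 := by nlinarith [sq_nonneg (3 * a - 2 * r)]
  have hB : (1 - a ^ 2) * (1 - r ^ 2) * (149 / 192 * a ^ 3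
        + (19 / 16 * (1 - a ^ 2) + 27 / 16 * a ^ 2) * (a * r) + a * (1 - a ^ 2) * r ^ 2 / 4) * y
      ≤ (1 - a ^ 2) * (1 - r ^ 2) * (149 / 192 * a ^ 2 * ((1 + a ^ 2) / 2)
        + (19 / 16 * (1 - a ^ 2) + 27 / 16 * a ^ 2) * (3 / 4 * a ^ 2 + r ^ 2 / 3)
        + (1 - a ^ 2) * r ^ 2 / 4 * ((1 + a ^ 2) / 2)) := by
    refine (mul_le_of_le_one_right (by positivity) hy').trans ?_
    gcongr ?_ * (?_ + ?_ + ?_)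
    · nlinarith [mul_le_mul_of_nonneg_left ham hu]
    · gcongr
    · nlinarith [mul_le_mul_of_nonneg_left ham (by positivity : 0 ≤ (1 - a ^ 2) * r ^ 2)]
  have hy2 : y ^ 2 ≤ 1 := pow_le_one₀ hy hy'
  -- With the linear terms bounded independently of `y`, the rest is the convex combination of the
  -- two ends with weights `y²` and `1 - y²`.
  have hA' := mul_le_mul_of_nonneg_left hA (sq_nonneg y)
  have hD' := mul_le_mul_of_nonneg_left hD (sub_nonneg.2 hy2)
  linarith

/-! ### The bound for the Hankel determinant. -/

theorem norm_one_sub_conj_mul_self {a : ℂ} (ha : ‖a‖ ≤ 1) : ‖1 - conj a * a‖ = 1 - ‖a‖ ^ 2 := by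
  rw [Complex.conj_mul', ← Complex.ofReal_pow, ← Complex.ofReal_one, ← Complex.ofReal_sub,
    Complex.norm_real, Real.norm_of_nonneg (sub_nonneg.2 (pow_le_one₀ (norm_nonneg _) ha))]

theorem norm_hankel_schur_le {a x y v : ℂ} (ha : ‖a‖ ≤ 1) (hx : ‖x‖ ≤ 1) (hy : ‖y‖ ≤ 1)
    (hv : ‖v‖ ≤ 1) {b c d : ℂ} (hb : b = (1 - conj a * a) * x)
    (hc : c = (1 - conj a * a) * ((1 - conj x * x) * y - conj a * x ^ 2))
    (hd : d = (1 - conj a * a) * ((1 - conj x * x) * (1 - conj y * y) * v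
        + conj a ^ 2 * x ^ 3 - (1 - conj x * x) * (2 * conj a * x * y + conj x * y ^ 2))) :
    ‖-(1099 / 9216) * a ^ 6 + 257 / 768 * a ^ 4 * b + 149 / 192 * a ^ 3 * c
      - 67 / 64 * a ^ 2 * b ^ 2 - 27 / 32 * a ^ 2 * d + 19 / 16 * a * b * c - 9 / 16 * b ^ 3
      + 9 / 8 * b * d - c ^ 2‖ ≤ 1 := by
  have hS := norm_one_sub_conj_mul_self ha
  have hT := norm_one_sub_conj_mul_self hx
  have hY := norm_one_sub_conj_mul_self hy
  obtain ⟨S, eS⟩ : ∃ S, S = 1 - conj a * a := ⟨_, rfl⟩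
  obtain ⟨T, eT⟩ : ∃ T, T = 1 - conj x * x := ⟨_, rfl⟩
  obtain ⟨Y, eY⟩ : ∃ Y, Y = 1 - conj y * y := ⟨_, rfl⟩
  rw [← eS] at hS hb hc hd
  rw [← eT] at hT hc hd
  rw [← eY] at hY hd
  have hx2 : conj x * x = 1 - T := by rw [eT]; ring
  -- Collecting before taking norms matters: `9/8 b d` and `c²` nearly cancel in the `x⁴` and `x² y`
  -- terms, leaving `1/8` and `-1/4`.
  have e : -(1099 / 9216) * a ^ 6 + 257 / 768 * a ^ 4 * b + 149 / 192 * a ^ 3 * c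
      - 67 / 64 * a ^ 2 * b ^ 2 - 27 / 32 * a ^ 2 * d + 19 / 16 * a * b * c - 9 / 16 * b ^ 3
      + 9 / 8 * b * d - c ^ 2 =
      257 / 768 * a ^ 4 * S * x - 1099 / 9216 * a ^ 6 - 149 / 192 * a ^ 3 * conj a * S * x ^ 2
      - 67 / 64 * a ^ 2 * S ^ 2 * x ^ 2 - 19 / 16 * a * conj a * S ^ 2 * x ^ 3
      - 9 / 16 * S ^ 3 * x ^ 3 - 27 / 32 * a ^ 2 * conj a ^ 2 * S * x ^ 3
      + 1 / 8 * S ^ 2 * conj a ^ 2 * x ^ 4 + 149 / 192 * S * T * a ^ 3 * y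
      + 19 / 16 * S ^ 2 * T * a * x * y + 27 / 16 * S * T * a ^ 2 * conj a * x * y
      - 1 / 4 * S ^ 2 * T * conj a * x ^ 2 * y - S ^ 2 * T * y ^ 2
      - 1 / 8 * S ^ 2 * T * x * conj x * y ^ 2 + 27 / 32 * S * T * a ^ 2 * conj x * y ^ 2
      + 9 / 8 * S ^ 2 * T * Y * x * v - 27 / 32 * S * T * Y * a ^ 2 * v := by
    rw [hb, hc, hd]
    linear_combination (-S ^ 2 * T * y ^ 2) * hx2
  have hbound : ‖257 / 768 * a ^ 4 * S * x - 1099 / 9216 * a ^ 6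
      - 149 / 192 * a ^ 3 * conj a * S * x ^ 2
      - 67 / 64 * a ^ 2 * S ^ 2 * x ^ 2 - 19 / 16 * a * conj a * S ^ 2 * x ^ 3
      - 9 / 16 * S ^ 3 * x ^ 3 - 27 / 32 * a ^ 2 * conj a ^ 2 * S * x ^ 3
      + 1 / 8 * S ^ 2 * conj a ^ 2 * x ^ 4 + 149 / 192 * S * T * a ^ 3 * y
      + 19 / 16 * S ^ 2 * T * a * x * y + 27 / 16 * S * T * a ^ 2 * conj a * x * y
      - 1 / 4 * S ^ 2 * T * conj a * x ^ 2 * y - S ^ 2 * T * y ^ 2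
      - 1 / 8 * S ^ 2 * T * x * conj x * y ^ 2 + 27 / 32 * S * T * a ^ 2 * conj x * y ^ 2
      + 9 / 8 * S ^ 2 * T * Y * x * v - 27 / 32 * S * T * Y * a ^ 2 * v‖ ≤
      257 / 768 * ‖a‖ ^ 4 * ‖S‖ * ‖x‖ + 1099 / 9216 * ‖a‖ ^ 6
      + 149 / 192 * ‖a‖ ^ 3 * ‖a‖ * ‖S‖ * ‖x‖ ^ 2
      + 67 / 64 * ‖a‖ ^ 2 * ‖S‖ ^ 2 * ‖x‖ ^ 2 + 19 / 16 * ‖a‖ * ‖a‖ * ‖S‖ ^ 2 * ‖x‖ ^ 3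
      + 9 / 16 * ‖S‖ ^ 3 * ‖x‖ ^ 3 + 27 / 32 * ‖a‖ ^ 2 * ‖a‖ ^ 2 * ‖S‖ * ‖x‖ ^ 3
      + 1 / 8 * ‖S‖ ^ 2 * ‖a‖ ^ 2 * ‖x‖ ^ 4 + 149 / 192 * ‖S‖ * ‖T‖ * ‖a‖ ^ 3 * ‖y‖
      + 19 / 16 * ‖S‖ ^ 2 * ‖T‖ * ‖a‖ * ‖x‖ * ‖y‖
      + 27 / 16 * ‖S‖ * ‖T‖ * ‖a‖ ^ 2 * ‖a‖ * ‖x‖ * ‖y‖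
      + 1 / 4 * ‖S‖ ^ 2 * ‖T‖ * ‖a‖ * ‖x‖ ^ 2 * ‖y‖ + ‖S‖ ^ 2 * ‖T‖ * ‖y‖ ^ 2
      + 1 / 8 * ‖S‖ ^ 2 * ‖T‖ * ‖x‖ * ‖x‖ * ‖y‖ ^ 2
      + 27 / 32 * ‖S‖ * ‖T‖ * ‖a‖ ^ 2 * ‖x‖ * ‖y‖ ^ 2
      + 9 / 8 * ‖S‖ ^ 2 * ‖T‖ * ‖Y‖ * ‖x‖ * 1 + 27 / 32 * ‖S‖ * ‖T‖ * ‖Y‖ * ‖a‖ ^ 2 * 1 := by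
    iterate 16 first | refine norm_add_le_of_le ?_ ?_ | refine norm_sub_le_of_le ?_ ?_
    -- The last two summands are the ones containing `v`.
    on_goal 16 => grw [← hv]
    on_goal 17 => grw [← hv]
    all_goals
      simp only [norm_mul, norm_pow, norm_div, Complex.norm_ofNat, RCLike.norm_conj, norm_one,
        le_refl]
  rw [e]
  refine hbound.trans ?_
  rw [hS, hT, hY]
  refine le_trans (le_of_eq ?_) (hankel_scalar_bound (norm_nonneg a) ha (norm_nonneg x) hx
    (norm_nonneg y) hy)
  ring

theorem StarlikeBean.mul_deriv_eq {f w : ℂ → ℂ} (hf : NormalizedAnalytic f)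
    (hne : ∀ z ∈ ball (0 : ℂ) 1, z ≠ 0 → f z ≠ 0)
    (h : ∀ z ∈ ball (0 : ℂ) 1, starlikeQuotient f z = beanFunction (w z)) :
    ∀ z ∈ ball (0 : ℂ) 1, z * deriv f z = beanFunction (w z) * f z := by
  intro z hz
  rcases eq_or_ne z 0 with rfl | h0
  · simp [hf.2.1]
  · rw [← h z hz, starlikeQuotient, Function.update_of_ne h0, div_mul_cancel₀ _ (hne z hz h0)]

theorem StarlikeBean.norm_hankelDet_le {f : ℂ → ℂ} (hf : StarlikeBean f) :
    ‖hankelDet f 3 1‖ ≤ 1 / 36 := by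
  obtain ⟨hn, hne, w, hw, h⟩ := hf
  obtain ⟨a, x, y, v, ha, hx, hy, hv, c1, c2, c3, c4⟩ := hw.exists_schur_parameters
  have e := hankelDet_eq_of_schwarz hn hw (StarlikeBean.mul_deriv_eq hn hne h) c1 c2 c3 c4
  have hb := norm_hankel_schur_le ha hx hy hv rfl rfl rfl
  rw [← e, norm_mul, Complex.norm_ofNat] at hb
  linarith

/-! ### Sharpness. -/

theorem isSchwarzFunction_cube : IsSchwarzFunction fun z => z ^ 3 := by
  refine ⟨by fun_prop, by norm_num, fun z hz => ?_⟩
  rw [norm_pow]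
  exact pow_le_of_le_one (norm_nonneg _) (mem_ball_zero_iff.1 hz).le three_ne_zero

/-- This makes the integrand analytic at `0`: `t ↦ φ(t³)` has derivative `0` there, which agrees
with the value of division by zero. -/
theorem extremal_integrand_eq_dslope :
    (fun t : ℂ => (beanFunction (t ^ 3) - 1) / t) = dslope (fun t => beanFunction (t ^ 3)) 0 := by
  funext t
  rcases eq_or_ne t 0 with rfl | ht
  · have hd := HasDerivAt.comp (0 : ℂ) (h₂ := beanFunction) (h := fun t : ℂ => t ^ 3)
      (differentiableAt_beanFunction (by simp)).hasDerivAt (hasDerivAt_pow 3 (0 : ℂ))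
    have : deriv (fun t : ℂ => beanFunction (t ^ 3)) 0 = 0 := hd.deriv.trans (by simp)
    simp [this]
  · rw [dslope_of_ne _ ht, slope_def_field]
    simp [beanFunction_zero]

/-- Integrals of analytic functions along radii are values of primitives. -/
theorem hasDerivAt_segmentIntegral {F : ℂ → ℂ} (hF : DifferentiableOn ℂ F (ball 0 1)) :
    ∀ z ∈ ball (0 : ℂ) 1, HasDerivAt (segmentIntegral F) (F z) z := by
  obtain ⟨G, hG⟩ := hF.isExactOn_ball
  have key : ∀ z ∈ ball (0 : ℂ) 1, segmentIntegral F z = G z - G 0 := by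
    intro z hz
    have hmem : ∀ s ∈ Set.uIcc (0 : ℝ) 1, (s : ℂ) * z ∈ ball (0 : ℂ) 1 := by
      intro s hs
      rw [Set.uIcc_of_le zero_le_one] at hs
      rw [mem_ball_zero_iff, norm_mul, Complex.norm_real, Real.norm_of_nonneg hs.1]
      exact (mul_le_of_le_one_left (norm_nonneg _) hs.2).trans_lt (mem_ball_zero_iff.1 hz)
    have hder : ∀ s ∈ Set.uIcc (0 : ℝ) 1,
        HasDerivAt (fun s : ℝ => G ((s : ℂ) * z)) (F ((s : ℂ) * z) * z) s := by
      intro s hs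
      have h1 : HasDerivAt (fun s : ℂ => s * z) z (s : ℂ) := by
        simpa using (hasDerivAt_id (s : ℂ)).mul_const z
      exact ((hG _ (hmem s hs)).comp (s : ℂ) h1).comp_ofReal
    have hcont : ContinuousOn (fun s : ℝ => F ((s : ℂ) * z) * z) (Set.uIcc 0 1) :=
      (hF.continuousOn.comp (by fun_prop) hmem).mul continuousOn_const
    rw [segmentIntegral, intervalIntegral.integral_eq_sub_of_hasDerivAt hder
      hcont.intervalIntegrable]
    simp
  intro z hz
  refine ((hG z hz).sub_const (G 0)).congr_of_eventuallyEq ?_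
  exact eventually_of_mem (isOpen_ball.mem_nhds hz) key

theorem hasDerivAt_extremalBean {z : ℂ} (hz : z ∈ ball (0 : ℂ) 1) :
    HasDerivAt extremalBean (beanFunction (z ^ 3) *
      Complex.exp (segmentIntegral (fun t => (beanFunction (t ^ 3) - 1) / t) z)) z := by
  have hF : DifferentiableOn ℂ (fun t : ℂ => (beanFunction (t ^ 3) - 1) / t) (ball 0 1) := by
    rw [extremal_integrand_eq_dslope]
    exact (Complex.differentiableOn_dslope (ball_mem_nhds _ one_pos)).2
      isSchwarzFunction_cube.differentiableOn_beanFunction_comp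
  refine ((hasDerivAt_id z).mul (hasDerivAt_segmentIntegral hF z hz).cexp).congr_deriv ?_
  rcases eq_or_ne z 0 with rfl | h0
  · simp [beanFunction_zero]
  · simp only [id]
    field_simp
    ring

theorem extremalBean_zero : extremalBean 0 = 0 := by simp [extremalBean]

theorem extremalBean_ne_zero {z : ℂ} (hz : z ≠ 0) : extremalBean z ≠ 0 :=
  mul_ne_zero hz (Complex.exp_ne_zero _)

theorem normalizedAnalytic_extremalBean : NormalizedAnalytic extremalBean := by
  refine ⟨fun z hz => (hasDerivAt_extremalBean hz).differentiableAt.differentiableWithinAt,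
    extremalBean_zero, ?_⟩
  rw [(hasDerivAt_extremalBean (mem_ball_self one_pos)).deriv]
  simp [beanFunction_zero, segmentIntegral]

theorem mul_deriv_extremalBean {z : ℂ} (hz : z ∈ ball (0 : ℂ) 1) :
    z * deriv extremalBean z = beanFunction (z ^ 3) * extremalBean z := by
  rw [(hasDerivAt_extremalBean hz).deriv, extremalBean]
  ring

theorem starlikeBean_extremalBean : StarlikeBean extremalBean := by
  refine ⟨normalizedAnalytic_extremalBean, fun z _ => extremalBean_ne_zero, _,
    isSchwarzFunction_cube, fun z hz => ?_⟩
  rcases eq_or_ne z 0 with rfl | h0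
  · simp [starlikeQuotient, beanFunction_zero]
  · rw [starlikeQuotient, Function.update_of_ne h0, mul_deriv_extremalBean hz,
      mul_div_cancel_right₀ _ (extremalBean_ne_zero h0)]

theorem taylorCoeff_cube (n : ℕ) : taylorCoeff (fun z => z ^ 3) n = if n = 3 then 1 else 0 := by
  rw [taylorCoeff, iteratedDeriv_fun_pow_zero]
  split_ifs with h <;> simp_all [Nat.factorial_ne_zero]

theorem hankelDet_extremalBean : 36 * hankelDet extremalBean 3 1 = -1 := by
  rw [hankelDet_eq_of_schwarz normalizedAnalytic_extremalBean isSchwarzFunction_cube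
    (fun z hz => mul_deriv_extremalBean hz) (taylorCoeff_cube 1) (taylorCoeff_cube 2)
    (taylorCoeff_cube 3) (taylorCoeff_cube 4)]
  norm_num

theorem mainTheorem1 :
    (∀ f : ℂ → ℂ, StarlikeBean f →
      (hankelDet f 3 1 =
          2 * taylorCoeff f 2 * taylorCoeff f 3 * taylorCoeff f 4 - taylorCoeff f 3 ^ 3
            - taylorCoeff f 4 ^ 2 - taylorCoeff f 2 ^ 2 * taylorCoeff f 5
            + taylorCoeff f 3 * taylorCoeff f 5) ∧
        ‖hankelDet f 3 1‖ ≤ 1 / 36) ∧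
      StarlikeBean extremalBean ∧ ‖hankelDet extremalBean 3 1‖ = 1 / 36 := by
  refine ⟨fun f hf => ⟨hankelDet_three_one hf.1.2.2, hf.norm_hankelDet_le⟩,
    starlikeBean_extremalBean, ?_⟩
  have h := congrArg norm hankelDet_extremalBean
  rw [norm_mul, Complex.norm_ofNat, norm_neg, norm_one] at h
  linarith
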